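/- Let $V$ be a finite set, let $z_s\in\mathbb R^d$ for $s\in V$, let $m:\mathbb R^d\to\mathbb R$ satisfy $0\le m(z)<\infty$ for all $z\in\mathbb R^d$, and let $\varphi:\mathbb R\to\mathbb R$ be such that $F(S)=\varphi\big(\sum_{s\in S}m(z_s)\big)$, $S\subseteq V$, is submodular (that is, $F(S\cup\{s\})-F(S)\ge F(T\cup\{s\})-F(T)$ whenever $S\subseteq T\subseteq V$ and $s\in V\setminus T$) and normalized ($F(\emptyset)=\varphi(0)=0$). Then for every $\epsilon>0$ there are fully connected ReLU networks $m_{\theta_1}:\mathbb R^d\to\mathbb R$ of width $d+4$ and $h_{\theta_2}:\mathbb R\to\mathbb R$ of width $5$ (some number $\ge 1$ of hidden layers, each with exactly that many ReLU neurons, followed by one affine output neuron), with $m_{\theta_1}\ge 0$ on $\mathbb R^d$ and $\int_0^\infty |h_{\theta_2}(b)|\,db<\infty$, such that $$\Big|F(S)-\int_0^{\sum_{s\in S}m_{\theta_1}(z_s)}\int_a^\infty h_{\theta_2}(b)\,db\,da\Big|\le\epsilon\qquad\text{for all } S\subseteq V .$$ If moreover $F$ is monotone ($F(S)\le F(T)$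 for $S\subseteq T$) and $\varphi$ is concave on $[0,\infty)$, then $h_{\theta_2}$ can in addition be chosen with $h_{\theta_2}\ge 0$ on $\mathbb R$. -/

import Mathlib

open MeasureTheory

/-- The rectified linear unit. -/
noncomputable def relu (x : ℝ) : ℝ := max x 0

/-- An affine map `ℝ^k → ℝ^n`, `x ↦ W x + b`, given by its parameters. -/
structure AffineLayer (k n : ℕ) where
  weight : Matrix (Fin n) (Fin k) ℝ
  bias : Fin n → ℝ

/-- The output of a layer of ReLU neurons: the affine map followed by ReLU in every coordinate. -/
noncomputable def AffineLayer.activate {k n : ℕ} (A : AffineLayer k n) (x : Fin k → ℝ) :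
    Fin n → ℝ :=
  fun i => relu (A.weight.mulVec x i + A.bias i)

/-- The parameters of a fully connected ReLU network with `d` inputs, one output, and at least one
hidden layer, in which every hidden layer consists of exactly `w` ReLU neurons. The output neuron
is affine. Setting weights to zero, a network with at most `w` neurons in each hidden layer is
of this form as well. -/
structure ReLUNetwork (d w : ℕ) where
  /-- the first hidden layer -/
  first : AffineLayer d w
  /-- the remaining hidden layers, from the input to the output -/
  hidden : List (AffineLayer w w)
  /-- weights of the output neuron -/
  outWeight : Fin w → ℝ
  /-- bias of the output neuron -/
  outBias : ℝ

/-- The function `ℝ^d → ℝ` that the network computes. -/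
noncomputable def ReLUNetwork.eval {d w : ℕ} (N : ReLUNetwork d w) (x : Fin d → ℝ) : ℝ :=
  (∑ i, N.outWeight i *
    N.hidden.foldl (fun y A => A.activate y) (N.first.activate x) i) + N.outBias

/-- The function of one real variable that a network with a single input computes. -/
noncomputable def ReLUNetwork.eval₁ {w : ℕ} (N : ReLUNetwork 1 w) (b : ℝ) : ℝ :=
  N.eval (fun _ => b)

/-- `F(s ∣ S) = F(S ∪ {s}) - F(S)`. -/
def marginal {V : Type*} [DecidableEq V] (F : Finset V → ℝ) (s : V) (S : Finset V) : ℝ :=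
  F (insert s S) - F S

/-- Submodularity as diminishing marginal utility. -/
def IsSubmodular {V : Type*} [DecidableEq V] (F : Finset V → ℝ) : Prop :=
  ∀ ⦃S T : Finset V⦄, S ⊆ T → ∀ s ∉ T, marginal F s T ≤ marginal F s S

/-- The double integral `∫_0^x ∫_a^∞ h(b) db da`. -/
noncomputable def doubleIntegral (h : ℝ → ℝ) (x : ℝ) : ℝ :=
  ∫ a in (0 : ℝ)..x, ∫ b in Set.Ioi a, h b

/-! Since `V` is finite, only finitely many points `z s` and finitely many sums of values of `m`
matter. The inner network reproduces `m` exactly at these points: a linear functional separates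
them, and a piecewise linear function of one variable then interpolates
(`exists_network_interpolating`). All error therefore comes from the outer function.

On the finitely many sums, `φ` is a combination of truncations `min x y` (`exists_sum_mul_min`).
Formally `min x y` is the double integral of a Dirac mass at `y`; replacing the mass by a hat of
integral `1` on `[y, y + 2 * η]` costs at most `2 * η`, uniformly in `x`
(`abs_doubleIntegral_bump_sub_min_le`). The resulting `h` is piecewise linear. Its coefficients are
the drops in slope of the interpolant of `φ`, together with its last slope, so they are nonnegative
when `φ` is concave and `F` monotone.

Both networks stay narrow because depth replaces width: the terms of a piecewise linear function are
accumulated one at a time in four registers. -/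

lemma relu_nonneg (x : ℝ) : 0 ≤ relu x := le_max_right _ _

lemma relu_of_nonneg {x : ℝ} (hx : 0 ≤ x) : relu x = x := max_eq_left hx

lemma relu_of_nonpos {x : ℝ} (hx : x ≤ 0) : relu x = 0 := max_eq_right hx

lemma relu_zero : relu 0 = 0 := relu_of_nonneg le_rfl

lemma relu_sub_relu_neg (x : ℝ) : relu x - relu (-x) = x := by
  rcases le_total 0 x with h | h
  · rw [relu_of_nonneg h, relu_of_nonpos (by linarith)]; ring
  · rw [relu_of_nonpos h, relu_of_nonneg (by linarith)]; ring

lemma continuous_relu : Continuous relu := continuous_id.max continuous_const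

/-! ### Narrow networks computing piecewise linear functions -/

/-- The state of the register machine that a narrow network simulates: an input `t`, a work
register `r`, and the positive and negative parts of an accumulator. -/
noncomputable def registers (k : ℕ) (t r acc : ℝ) : Fin (k + 4) → ℝ :=
  Matrix.vecCons t (Matrix.vecCons r (Matrix.vecCons (relu acc) (Matrix.vecCons (relu (-acc)) 0)))

/-- The layer that loads `relu (t - u)` into the work register. -/
def loadLayer (k : ℕ) (u : ℝ) : AffineLayer (k + 4) (k + 4) where
  weight := Matrix.of (Matrix.vecCons (Matrix.vecCons 1 0) (Matrix.vecCons (Matrix.vecCons 1 0)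
    (Matrix.vecCons (Matrix.vecCons 0 (Matrix.vecCons 0 (Matrix.vecCons 1 (Matrix.vecCons (-1) 0))))
    (Matrix.vecCons
      (Matrix.vecCons 0 (Matrix.vecCons 0 (Matrix.vecCons (-1) (Matrix.vecCons 1 0)))) 0))))
  bias := Matrix.vecCons 0 (Matrix.vecCons (-u) 0)

/-- The layer that adds `α` times the work register to the accumulator and clears the register. -/
def addLayer (k : ℕ) (α : ℝ) : AffineLayer (k + 4) (k + 4) where
  weight := Matrix.of (Matrix.vecCons (Matrix.vecCons 1 0) (Matrix.vecCons 0
    (Matrix.vecCons (Matrix.vecCons 0 (Matrix.vecCons α (Matrix.vecCons 1 (Matrix.vecCons (-1) 0))))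
    (Matrix.vecCons
      (Matrix.vecCons 0 (Matrix.vecCons (-α) (Matrix.vecCons (-1) (Matrix.vecCons 1 0)))) 0))))
  bias := 0

/-- ReLU fixes `t` because `t ≥ 0`. The signed accumulator survives because each layer rebuilds it
as the difference of its two parts and splits it again. -/
lemma loadLayer_activate (k : ℕ) {t : ℝ} (ht : 0 ≤ t) (u r acc : ℝ) :
    (loadLayer k u).activate (registers k t r acc) = registers k t (relu (t - u)) acc := by
  have h := relu_sub_relu_neg acc
  funext i
  refine Fin.cases ?_ (fun i => Fin.cases ?_ (fun i => Fin.cases ?_ (fun i => Fin.cases ?_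
    (fun i => ?_) i) i) i) i
  · simp [AffineLayer.activate, loadLayer, registers, relu_of_nonneg ht]
  · simp [AffineLayer.activate, loadLayer, registers, sub_eq_add_neg]
  · simp [AffineLayer.activate, loadLayer, registers]
    exact congrArg relu (by linarith)
  · simp [AffineLayer.activate, loadLayer, registers]
    exact congrArg relu (by linarith)
  · simp [AffineLayer.activate, loadLayer, registers, relu_zero]

lemma addLayer_activate (k : ℕ) {t : ℝ} (ht : 0 ≤ t) (α r acc : ℝ) :
    (addLayer k α).activate (registers k t r acc) = registers k t 0 (acc + α * r) := by
  have h := relu_sub_relu_neg acc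
  funext i
  refine Fin.cases ?_ (fun i => Fin.cases ?_ (fun i => Fin.cases ?_ (fun i => Fin.cases ?_
    (fun i => ?_) i) i) i) i
  · simp [AffineLayer.activate, addLayer, registers, relu_of_nonneg ht]
  · simp [AffineLayer.activate, addLayer, registers, relu_zero]
  · simp [AffineLayer.activate, addLayer, registers]
    exact congrArg relu (by linarith)
  · simp [AffineLayer.activate, addLayer, registers]
    exact congrArg relu (by linarith)
  · simp [AffineLayer.activate, addLayer, registers, relu_zero]

/-- The first layer, which loads `relu (a ⬝ᵥ x + c)` into the input register. -/
def inputLayer {d : ℕ} (k : ℕ) (a : Fin d → ℝ) (c : ℝ) : AffineLayer d (k + 4) where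
  weight := Matrix.of (Matrix.vecCons a 0)
  bias := Matrix.vecCons c 0

lemma inputLayer_activate {d : ℕ} (k : ℕ) (a : Fin d → ℝ) (c : ℝ) (x : Fin d → ℝ) :
    (inputLayer k a c).activate x = registers k (relu (a ⬝ᵥ x + c)) 0 0 := by
  funext i
  refine Fin.cases ?_ (fun i => Fin.cases ?_ (fun i => Fin.cases ?_ (fun i => Fin.cases ?_
    (fun i => ?_) i) i) i) i <;>
  simp [AffineLayer.activate, inputLayer, registers, Matrix.cons_mulVec, relu_zero]

/-- The continuous piecewise linear function with slope change `p.1` at `p.2` for `p ∈ l`. -/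
noncomputable def reluSum (l : List (ℝ × ℝ)) (t : ℝ) : ℝ :=
  (l.map fun p => p.1 * relu (t - p.2)).sum

/-- The hidden layers that add `reluSum l t` to the accumulator. -/
def reluSumLayers (k : ℕ) (l : List (ℝ × ℝ)) : List (AffineLayer (k + 4) (k + 4)) :=
  l.flatMap fun p => [loadLayer k p.2, addLayer k p.1]

lemma foldl_reluSumLayers (k : ℕ) {t : ℝ} (ht : 0 ≤ t) (l : List (ℝ × ℝ)) (acc : ℝ) :
    (reluSumLayers k l).foldl (fun y A => A.activate y) (registers k t 0 acc) =
      registers k t 0 (acc + reluSum l t) := by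
  induction l generalizing acc with
  | nil => simp [reluSumLayers, reluSum]
  | cons p l ih =>
    have : reluSumLayers k (p :: l) = loadLayer k p.2 :: addLayer k p.1 :: reluSumLayers k l := rfl
    rw [this, List.foldl_cons, List.foldl_cons, loadLayer_activate k ht, addLayer_activate k ht, ih]
    simp [reluSum, add_assoc]

/-- The functions `t ↦ ∑ αᵢ relu (t - uᵢ)`. -/
noncomputable def reluSpan : Submodule ℝ (ℝ → ℝ) :=
  Submodule.span ℝ (Set.range fun u t => relu (t - u))

lemma relu_sub_mem_reluSpan (u : ℝ) : (fun t => relu (t - u)) ∈ reluSpan :=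
  Submodule.subset_span ⟨u, rfl⟩

lemma exists_reluSum_of_mem_reluSpan {f : ℝ → ℝ} (hf : f ∈ reluSpan) : ∃ l, f = reluSum l := by
  induction hf using Submodule.span_induction with
  | mem f hf =>
    obtain ⟨u, rfl⟩ := hf
    exact ⟨[(1, u)], by funext t; simp [reluSum]⟩
  | zero => exact ⟨[], by funext t; simp [reluSum]⟩
  | add f g _ _ hf hg =>
    obtain ⟨l, rfl⟩ := hf
    obtain ⟨l', rfl⟩ := hg
    exact ⟨l ++ l', by funext t; simp [reluSum]⟩
  | smul a f _ hf =>
    obtain ⟨l, rfl⟩ := hf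
    refine ⟨l.map fun p => (a * p.1, p.2), ?_⟩
    funext t
    simp [reluSum, Function.comp_def, ← List.sum_map_mul_left, mul_assoc]

lemma exists_network_eval_eq {d : ℕ} (k : ℕ) {f : ℝ → ℝ} (hf : f ∈ reluSpan) (a : Fin d → ℝ)
    (c : ℝ) : ∃ N : ReLUNetwork d (k + 4), ∀ x, N.eval x = f (relu (a ⬝ᵥ x + c)) := by
  obtain ⟨l, rfl⟩ := exists_reluSum_of_mem_reluSpan hf
  refine ⟨⟨inputLayer k a c, reluSumLayers k l, Matrix.vecCons 0 (Matrix.vecCons 0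
    (Matrix.vecCons 1 (Matrix.vecCons (-1) 0))), 0⟩, fun x => ?_⟩
  have h := relu_sub_relu_neg (reluSum l (relu (a ⬝ᵥ x + c)))
  simp only [ReLUNetwork.eval, inputLayer_activate, foldl_reluSumLayers k (relu_nonneg _)]
  simp [registers, Fin.sum_univ_succ]
  linarith

/-- Reading off only the positive part of the accumulator gives a final ReLU for free; this makes
the inner network nonnegative everywhere. -/
lemma exists_network_eval_eq_relu {d : ℕ} (k : ℕ) {f : ℝ → ℝ} (hf : f ∈ reluSpan) (a : Fin d → ℝ)
    (c : ℝ) : ∃ N : ReLUNetwork d (k + 4), ∀ x, N.eval x = relu (f (relu (a ⬝ᵥ x + c))) := by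
  obtain ⟨l, rfl⟩ := exists_reluSum_of_mem_reluSpan hf
  refine ⟨⟨inputLayer k a c, reluSumLayers k l, Matrix.vecCons 0 (Matrix.vecCons 0
    (Matrix.vecCons 1 0)), 0⟩, fun x => ?_⟩
  simp only [ReLUNetwork.eval, inputLayer_activate, foldl_reluSumLayers k (relu_nonneg _)]
  simp [registers, Fin.sum_univ_succ]

/-! ### Exact interpolation of finitely many values -/

/-- Adding the points in increasing order, a new kink between the earlier points and `p` corrects
the value at `p` and vanishes at all earlier points. -/
lemma exists_mem_reluSpan_interpolating (P : Finset ℝ) (v : ℝ → ℝ) :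
    ∃ f ∈ reluSpan, ∀ p ∈ P, f p = v p := by
  induction P using Finset.induction_on_max with
  | empty => exact ⟨0, zero_mem _, by simp⟩
  | insert p P hP ih =>
    obtain ⟨f, hf, hfv⟩ := ih
    obtain ⟨u, hup, hu⟩ : ∃ u < p, ∀ y ∈ P, y ≤ u := by
      rcases P.eq_empty_or_nonempty with rfl | hne
      · exact ⟨p - 1, by linarith, by simp⟩
      · exact ⟨P.max' hne, hP _ (P.max'_mem hne), fun y hy => P.le_max' y hy⟩
    refine ⟨f + ((v p - f p) / (p - u)) • fun t => relu (t - u),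
      add_mem hf (Submodule.smul_mem _ _ (relu_sub_mem_reluSpan u)), fun y hy => ?_⟩
    have hpu : p - u ≠ 0 := by linarith
    rcases Finset.mem_insert.1 hy with rfl | hy
    · simp only [Pi.add_apply, Pi.smul_apply, smul_eq_mul, relu_of_nonneg (sub_nonneg.2 hup.le)]
      field_simp
      ring
    · simp [relu_of_nonpos (sub_nonpos.2 (hu y hy)), hfv y hy]

/-- Some functional is nonzero on each of the finitely many nonzero differences `z s - z t`. -/
lemma exists_dotProduct_injOn {V : Type*} [Finite V] {d : ℕ} (z : V → Fin d → ℝ) :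
    ∃ a : Fin d → ℝ, ∀ s t, a ⬝ᵥ z s = a ⬝ᵥ z t → z s = z t := by
  obtain ⟨f, hf⟩ := Module.exists_dual_forall_apply_ne_zero (K := ℝ)
    (fun p : {p : V × V // z p.1 ≠ z p.2} => z p.1.1 - z p.1.2) (fun p => sub_ne_zero.2 p.2)
  have key : ∀ x, (fun i => f (Pi.single i 1)) ⬝ᵥ x = f x := fun x => by
    rw [LinearMap.pi_apply_eq_sum_univ f x]
    simp only [dotProduct, smul_eq_mul]
    exact Finset.sum_congr rfl fun i _ => by
      rw [mul_comm]; congr 2; funext j; simp [Pi.single_apply, eq_comm]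
  refine ⟨fun i => f (Pi.single i 1), fun s t hst => ?_⟩
  by_contra hne
  rw [key, key] at hst
  exact hf ⟨(s, t), hne⟩ (by rw [map_sub, hst, sub_self])

/-- A ReLU network of width `d + 4` with nonnegative output interpolates finitely many values. -/
lemma exists_network_interpolating {V : Type*} [Fintype V] {d : ℕ} (z : V → Fin d → ℝ)
    (m : (Fin d → ℝ) → ℝ) (hm : ∀ x, 0 ≤ m x) :
    ∃ N : ReLUNetwork d (d + 4), (∀ x, 0 ≤ N.eval x) ∧ ∀ s, N.eval (z s) = m (z s) := by
  classical
  obtain ⟨a, ha⟩ := exists_dotProduct_injOn z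
  -- This shift makes every projected point nonnegative, so the ReLU of the first layer does not
  -- alter it.
  set c : ℝ := ∑ s, |a ⬝ᵥ z s|
  have hc : ∀ s, 0 ≤ a ⬝ᵥ z s + c := fun s => by
    have := Finset.single_le_sum (f := fun s => |a ⬝ᵥ z s|) (fun i _ => abs_nonneg _)
      (Finset.mem_univ s)
    have h2 := neg_abs_le (a ⬝ᵥ z s)
    simp only [c]
    linarith
  have hfac : ∃ v : ℝ → ℝ, ∀ s, v (a ⬝ᵥ z s + c) = m (z s) := by
    have : Function.FactorsThrough (fun s => m (z s)) (fun s => a ⬝ᵥ z s + c) :=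
      fun s t hst => congrArg m (ha s t (add_right_cancel hst))
    exact ⟨_, fun s => this.extend_apply (fun _ => 0) s⟩
  obtain ⟨v, hv⟩ := hfac
  obtain ⟨f, hf, hfv⟩ :=
    exists_mem_reluSpan_interpolating (Finset.univ.image fun s => a ⬝ᵥ z s + c) v
  obtain ⟨N, hN⟩ := exists_network_eval_eq_relu d hf a c
  refine ⟨N, fun x => hN x ▸ relu_nonneg _, fun s => ?_⟩
  rw [hN, relu_of_nonneg (hc s), hfv _ (Finset.mem_image_of_mem _ (Finset.mem_univ s)), hv,
    relu_of_nonneg (hm _)]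

/-! ### Mixtures of truncations -/

/-- Every function on finitely many positive points is a combination of the truncations
`x ↦ min x y`, and the coefficients are nonnegative if it is concave with its maximum at the
largest point. -/
lemma exists_sum_mul_min (P : Finset ℝ) (hP : ∀ y ∈ P, 0 < y) (f : ℝ → ℝ) (hf : f 0 = 0) :
    ∃ c : ℝ → ℝ, (∀ x ∈ insert 0 P, ∑ y ∈ P, c y * min x y = f x) ∧
      (ConcaveOn ℝ (Set.Ici 0) f →
        (∀ M ∈ insert 0 P, (∀ y ∈ P, y ≤ M) → ∀ x ∈ insert 0 P, f x ≤ f M) →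
        ∀ y ∈ P, 0 ≤ c y) := by
  induction P using Finset.induction_on_max generalizing f with
  | empty => exact ⟨0, by simp [hf], by simp⟩
  | insert p P hlt ih =>
    have hPpos : ∀ y ∈ P, 0 < y := fun y hy => hP y (Finset.mem_insert_of_mem hy)
    have hp : 0 < p := hP p (Finset.mem_insert_self _ _)
    have hpP : p ∉ P := fun h => lt_irrefl _ (hlt p h)
    set q := (insert 0 P).max' ⟨0, Finset.mem_insert_self _ _⟩ with hqdef
    have hqmem : q ∈ insert 0 P := Finset.max'_mem _ _
    have hqle : ∀ y ∈ insert 0 P, y ≤ q := fun y hy => Finset.le_max' _ y hy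
    have hq0 : 0 ≤ q := hqle 0 (Finset.mem_insert_self _ _)
    have hlt0 : ∀ y ∈ insert 0 P, 0 ≤ y ∧ y < p := fun y hy => by
      rcases Finset.mem_insert.1 hy with rfl | hy
      · exact ⟨le_rfl, hp⟩
      · exact ⟨(hPpos y hy).le, hlt y hy⟩
    have hqp : q < p := (hlt0 q hqmem).2
    have hpq : p - q ≠ 0 := by linarith
    -- The slope of the last chord becomes the coefficient of `min x p`. The remainder `f x - s * x`
    -- takes equal values at `q` and `p`, as does every `min x y` with `y ∈ P`.
    set s := (f p - f q) / (p - q) with hs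
    have hspq : s * (p - q) = f p - f q := by rw [hs]; field_simp
    obtain ⟨c, hc, hcnn⟩ := ih hPpos (fun x => f x - s * x) (by simp [hf])
    have hmem : ∀ y ∈ insert 0 P, y ∈ insert 0 (insert p P) := fun y hy => by
      simp only [Finset.mem_insert] at hy ⊢; tauto
    have hpmem : p ∈ insert 0 (insert p P) := by simp
    have hsum : ∀ x, ∑ y ∈ insert p P, (if y = p then s else c y) * min x y =
        s * min x p + ∑ y ∈ P, c y * min x y := fun x => by
      rw [Finset.sum_insert hpP, if_pos rfl]
      congr 1
      exact Finset.sum_congr rfl fun y hy => by rw [if_neg (hlt y hy).ne]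
    refine ⟨fun y => if y = p then s else c y, fun x hx => ?_, fun hconc hmax y hy => ?_⟩
    · rw [hsum]
      have hx' : x = p ∨ x ∈ insert 0 P := by simp only [Finset.mem_insert] at hx ⊢; tauto
      rcases hx' with rfl | hx'
      · have : ∑ y ∈ P, c y * min x y = ∑ y ∈ P, c y * min q y :=
          Finset.sum_congr rfl fun y hy => by
            rw [min_eq_right (hlt y hy).le,
              min_eq_right (hqle y (Finset.mem_insert_of_mem hy))]
        rw [this, hc q hqmem, min_self]
        linarith
      · rw [hc x hx', min_eq_left (hlt0 x hx').2.le]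
        ring
    · have hple : ∀ y ∈ insert p P, y ≤ p := fun y hy => by
        rcases Finset.mem_insert.1 hy with rfl | hy
        · exact le_rfl
        · exact (hlt y hy).le
      by_cases hyp : y = p
      · simp only [if_pos hyp]
        exact div_nonneg (sub_nonneg.2 (hmax p hpmem hple q (hmem q hqmem))) (by linarith)
      · simp only [if_neg hyp]
        refine hcnn ?_ (fun M hM hMmax x hx => ?_) y
          ((Finset.mem_insert.1 hy).resolve_left hyp)
        · refine hconc.sub ⟨convex_Ici 0, fun x _ y _ a b _ _ _ => le_of_eq ?_⟩
          simp only [smul_eq_mul]; ring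
        · have hMq : M = q := le_antisymm (hqle M hM) (by
            rcases Finset.mem_insert.1 hqmem with h | h
            · rw [h]; exact (hlt0 M hM).1
            · exact hMmax q h)
          subst hMq
          rcases (hqle x hx).eq_or_lt with h | h
          · rw [h]
          -- By concavity the chord from `x` to `q` has slope at least `s`, so `f x - s * x` is
          -- maximal at `q` and the induction hypothesis applies.
          · have := hconc.slope_anti_adjacent (Set.mem_Ici.2 (hlt0 x hx).1)
              (Set.mem_Ici.2 hp.le) h hqp
            rw [← hs, le_div_iff₀ (by linarith)] at this
            linarith

/-! ### Smoothed truncations as double integrals -/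

/-- The piecewise linear hat with support `[y, y + 2 * η]` and height `η`. -/
noncomputable def hat (η y t : ℝ) : ℝ :=
  relu (t - y) - 2 * relu (t - (y + η)) + relu (t - (y + 2 * η))

lemma hat_mem_reluSpan (η y : ℝ) : hat η y ∈ reluSpan :=
  add_mem (sub_mem (relu_sub_mem_reluSpan y)
    (Submodule.smul_mem _ 2 (relu_sub_mem_reluSpan (y + η)))) (relu_sub_mem_reluSpan (y + 2 * η))

lemma continuous_hat (η y : ℝ) : Continuous (hat η y) := by
  have := continuous_relu
  unfold hat
  fun_prop

lemma hat_nonneg {η : ℝ} (hη : 0 < η) (y t : ℝ) : 0 ≤ hat η y t := by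
  unfold hat relu
  grind

lemma hat_of_le {η : ℝ} (hη : 0 < η) {y t : ℝ} (h : t ≤ y) : hat η y t = 0 := by
  unfold hat relu
  grind

lemma hat_of_ge {η : ℝ} (hη : 0 < η) {y t : ℝ} (h : y + 2 * η ≤ t) : hat η y t = 0 := by
  unfold hat relu
  grind

lemma hasCompactSupport_hat {η : ℝ} (hη : 0 < η) (y : ℝ) : HasCompactSupport (hat η y) :=
  HasCompactSupport.intro (isCompact_Icc (a := y) (b := y + 2 * η)) fun t ht => by
    rcases le_total t y with h | h
    · exact hat_of_le hη h
    · exact hat_of_ge hη (le_of_not_ge fun h' => ht ⟨h, h'⟩)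

lemma integrable_hat {η : ℝ} (hη : 0 < η) (y : ℝ) : Integrable (hat η y) :=
  (continuous_hat η y).integrable_of_hasCompactSupport (hasCompactSupport_hat hη y)

lemma integral_hat_pos {η : ℝ} (hη : 0 < η) (y : ℝ) : 0 < ∫ t, hat η y t := by
  refine (continuous_hat η y).integral_pos_of_hasCompactSupport_nonneg_nonzero (x := y + η)
    (hasCompactSupport_hat hη y) (hat_nonneg hη y) ?_
  unfold hat relu
  grind

/-- The hat normalized to integral `1`. -/
noncomputable def bump (η y t : ℝ) : ℝ := (∫ s, hat η y s)⁻¹ * hat η y t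

lemma bump_mem_reluSpan (η y : ℝ) : bump η y ∈ reluSpan :=
  Submodule.smul_mem _ _ (hat_mem_reluSpan η y)

lemma bump_nonneg {η : ℝ} (hη : 0 < η) (y t : ℝ) : 0 ≤ bump η y t :=
  mul_nonneg (inv_nonneg.2 (integral_hat_pos hη y).le) (hat_nonneg hη y t)

lemma bump_of_le {η : ℝ} (hη : 0 < η) {y t : ℝ} (h : t ≤ y) : bump η y t = 0 := by
  rw [bump, hat_of_le hη h, mul_zero]

lemma bump_of_ge {η : ℝ} (hη : 0 < η) {y t : ℝ} (h : y + 2 * η ≤ t) : bump η y t = 0 := by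
  rw [bump, hat_of_ge hη h, mul_zero]

lemma integrable_bump {η : ℝ} (hη : 0 < η) (y : ℝ) : Integrable (bump η y) :=
  (integrable_hat hη y).const_mul _

lemma integral_bump {η : ℝ} (hη : 0 < η) (y : ℝ) : ∫ t, bump η y t = 1 := by
  simp only [bump]
  rw [integral_const_mul, inv_mul_cancel₀ (integral_hat_pos hη y).ne']

lemma tail_bump_nonneg {η : ℝ} (hη : 0 < η) (y a : ℝ) : 0 ≤ ∫ t in Set.Ioi a, bump η y t :=
  integral_nonneg fun t => bump_nonneg hη y t

lemma tail_bump_le_one {η : ℝ} (hη : 0 < η) (y a : ℝ) : ∫ t in Set.Ioi a, bump η y t ≤ 1 := by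
  rw [← integral_bump hη y]
  exact setIntegral_le_integral (integrable_bump hη y) (ae_of_all _ (bump_nonneg hη y))

lemma tail_bump_of_le {η : ℝ} (hη : 0 < η) {y a : ℝ} (h : a ≤ y) :
    ∫ t in Set.Ioi a, bump η y t = 1 := by
  rw [← integral_bump hη y]
  refine setIntegral_eq_integral_of_forall_compl_eq_zero fun t ht => bump_of_le hη ?_
  exact (not_lt.1 ht).trans h

lemma tail_bump_of_ge {η : ℝ} (hη : 0 < η) {y a : ℝ} (h : y + 2 * η ≤ a) :
    ∫ t in Set.Ioi a, bump η y t = 0 :=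
  setIntegral_eq_zero_of_forall_eq_zero fun _ ht => bump_of_ge hη (h.trans (le_of_lt ht))

/-- Monotonicity yields interval integrability of the tail. -/
lemma antitone_tail_bump {η : ℝ} (hη : 0 < η) (y : ℝ) :
    Antitone fun a => ∫ t in Set.Ioi a, bump η y t := fun _ _ h =>
  setIntegral_mono_set (integrable_bump hη y).integrableOn (ae_of_all _ (bump_nonneg hη y))
    (Set.Ioi_subset_Ioi h).eventuallyLE

/-- The tail integral equals `1` up to `y`, lies in `[0, 1]`, and vanishes from `y + 2 * η` on, so
only an interval of length `2 * η` contributes error. -/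
lemma abs_doubleIntegral_bump_sub_min_le {η : ℝ} (hη : 0 < η) {x y : ℝ} (hy : 0 ≤ y) :
    |doubleIntegral (bump η y) x - min x y| ≤ 2 * η := by
  unfold doubleIntegral
  set T : ℝ → ℝ := fun a => ∫ t in Set.Ioi a, bump η y t with hT
  have hint : ∀ u v, IntervalIntegrable T volume u v := fun u v =>
    (antitone_tail_bump hη y).intervalIntegrable
  have hone : ∀ w ≤ y, ∫ a in (0 : ℝ)..w, T a = w := fun w hw => by
    rw [intervalIntegral.integral_congr (g := fun _ => 1) fun a ha =>
      tail_bump_of_le hη (ha.2.trans (max_le hy hw))]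
    simp
  rcases le_total x y with h | h
  · rw [hone x h, min_eq_left h, sub_self, abs_zero]; linarith
  · rw [min_eq_right h, ← intervalIntegral.integral_add_adjacent_intervals (hint 0 y) (hint y x),
      hone y le_rfl, add_sub_cancel_left, abs_of_nonneg
      (intervalIntegral.integral_nonneg h fun a _ => tail_bump_nonneg hη y a)]
    -- The maximum treats `x` inside and beyond the support of the bump together.
    have hzero : ∫ a in (y + 2 * η)..(max x (y + 2 * η)), T a = 0 := by
      rw [intervalIntegral.integral_congr (g := fun _ => 0) fun a ha => tail_bump_of_ge hη ?_]
      · simp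
      · rw [Set.uIcc_of_le (le_max_right _ _)] at ha
        exact ha.1
    calc ∫ a in y..x, T a ≤ ∫ a in y..(max x (y + 2 * η)), T a := by
          rw [← intervalIntegral.integral_add_adjacent_intervals (hint y x)
            (hint x (max x (y + 2 * η)))]
          exact le_add_of_nonneg_right (intervalIntegral.integral_nonneg (le_max_left _ _)
            fun a _ => tail_bump_nonneg hη y a)
      _ = ∫ a in y..(y + 2 * η), T a := by
          rw [← intervalIntegral.integral_add_adjacent_intervals (hint y (y + 2 * η))
            (hint _ (max x (y + 2 * η))), hzero, add_zero]
      _ ≤ ∫ a in y..(y + 2 * η), (1 : ℝ) :=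
          intervalIntegral.integral_mono_on (by linarith) (hint _ _) intervalIntegrable_const
            fun a _ => tail_bump_le_one hη y a
      _ = 2 * η := by simp

lemma doubleIntegral_sum_bump {η : ℝ} (hη : 0 < η) (P : Finset ℝ) (c : ℝ → ℝ) (x : ℝ) :
    doubleIntegral (fun t => ∑ y ∈ P, c y * bump η y t) x =
      ∑ y ∈ P, c y * doubleIntegral (bump η y) x := by
  unfold doubleIntegral
  have h : ∀ a : ℝ, ∫ t in Set.Ioi a, ∑ y ∈ P, c y * bump η y t =
      ∑ y ∈ P, c y * ∫ t in Set.Ioi a, bump η y t := fun a => by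
    rw [integral_finsetSum P fun y _ => ((integrable_bump hη y).const_mul (c y)).integrableOn]
    simp only [integral_const_mul]
  simp only [h]
  rw [intervalIntegral.integral_finsetSum fun y _ =>
    (antitone_tail_bump hη y).intervalIntegrable.const_mul (c y)]
  simp only [intervalIntegral.integral_const_mul]

lemma abs_doubleIntegral_sum_bump_sub_le {η : ℝ} (hη : 0 < η) (P : Finset ℝ) (hP : ∀ y ∈ P, 0 < y)
    (c : ℝ → ℝ) (x : ℝ) :
    |∑ y ∈ P, c y * min x y - doubleIntegral (fun t => ∑ y ∈ P, c y * bump η y t) x| ≤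
      (∑ y ∈ P, |c y|) * (2 * η) := by
  rw [doubleIntegral_sum_bump hη, ← Finset.sum_sub_distrib, Finset.sum_mul]
  refine (Finset.abs_sum_le_sum_abs _ _).trans (Finset.sum_le_sum fun y hy => ?_)
  rw [← mul_sub, abs_mul, abs_sub_comm]
  exact mul_le_mul_of_nonneg_left (abs_doubleIntegral_bump_sub_min_le hη (hP y hy).le)
    (abs_nonneg _)

/-- Combinations of bumps at positive points are computed by networks of width `5`. -/
lemma exists_network_sum_bump {η : ℝ} (hη : 0 < η) (P : Finset ℝ) (hP : ∀ y ∈ P, 0 < y)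
    (c : ℝ → ℝ) :
    ∃ N : ReLUNetwork 1 5, N.eval₁ = fun t => ∑ y ∈ P, c y * bump η y t := by
  have hmem : (fun t => ∑ y ∈ P, c y * bump η y t) ∈ reluSpan := by
    have : (fun t => ∑ y ∈ P, c y * bump η y t) = ∑ y ∈ P, c y • bump η y := by
      funext t; simp
    rw [this]
    exact sum_mem fun y _ => Submodule.smul_mem _ _ (bump_mem_reluSpan η y)
  obtain ⟨N, hN⟩ := exists_network_eval_eq 1 hmem (fun _ : Fin 1 => 1) 0
  refine ⟨N, ?_⟩
  funext t
  refine (hN fun _ => t).trans ?_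
  simp only [dotProduct, Finset.univ_unique, Finset.sum_singleton, one_mul, add_zero]
  -- The network sees only `relu t`; nothing is lost, since bumps at positive points vanish for `t ≤
  -- 0`.
  rcases le_total 0 t with h | h
  · rw [relu_of_nonneg h]
  · rw [relu_of_nonpos h]
    exact Finset.sum_congr rfl fun y hy => by
      rw [bump_of_le hη (hP y hy).le, bump_of_le hη (h.trans (hP y hy).le)]

/-! ### The approximation theorem -/

theorem proposition3 {V : Type*} [Fintype V] [DecidableEq V] {d : ℕ}
    (z : V → Fin d → ℝ)
    (m : (Fin d → ℝ) → ℝ) (hm : ∀ x, 0 ≤ m x)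
    (φ : ℝ → ℝ) (F : Finset V → ℝ)
    (hF : ∀ S, F S = φ (∑ s ∈ S, m (z s)))
    (hsub : IsSubmodular F) (hnorm : F ∅ = 0)
    (ε : ℝ) (hε : 0 < ε) :
    ∃ (mθ : ReLUNetwork d (d + 4)) (hθ : ReLUNetwork 1 5),
      (∀ x, 0 ≤ mθ.eval x) ∧
      IntegrableOn hθ.eval₁ (Set.Ioi 0) ∧
      (ConcaveOn ℝ (Set.Ici 0) φ → Monotone F → ∀ b, 0 ≤ hθ.eval₁ b) ∧
      ∀ S : Finset V,
        |F S - doubleIntegral hθ.eval₁ (∑ s ∈ S, mθ.eval (z s))| ≤ ε := by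
  obtain ⟨mθ, hmθ, hmeq⟩ := exists_network_interpolating z m hm
  have hφ0 : φ 0 = 0 := by simpa [hF] using hnorm
  -- Truncation points must be positive; the value at `0` is already matched by `φ 0 = 0`.
  set P : Finset ℝ := (Finset.univ.image fun S : Finset V => ∑ s ∈ S, m (z s)).erase 0
  have hsum : ∀ S : Finset V, ∑ s ∈ S, m (z s) ∈ insert 0 P := fun S => by
    simp only [P, Finset.mem_insert, Finset.mem_erase, Finset.mem_image, Finset.mem_univ,
      true_and, exists_apply_eq_apply, and_true]
    exact eq_or_ne _ _
  have hsum' : ∀ x ∈ insert 0 P, ∃ S : Finset V, ∑ s ∈ S, m (z s) = x := fun x hx => by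
    rcases Finset.mem_insert.1 hx with rfl | hx
    · exact ⟨∅, Finset.sum_empty⟩
    · simpa using Finset.mem_of_mem_erase hx
  have hP : ∀ y ∈ P, 0 < y := fun y hy => by
    obtain ⟨S, rfl⟩ := hsum' y (Finset.mem_insert_of_mem hy)
    exact lt_of_le_of_ne (Finset.sum_nonneg fun s _ => hm _) (Finset.ne_of_mem_erase hy).symm
  obtain ⟨c, hc, hcnn⟩ := exists_sum_mul_min P hP φ hφ0
  have hC : 0 ≤ ∑ y ∈ P, |c y| := Finset.sum_nonneg fun _ _ => abs_nonneg _
  -- Chosen so that `(∑ y ∈ P, |c y|) * (2 * η) ≤ ε`; the `+ 1` keeps the denominator positive when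
  -- all coefficients vanish.
  set η : ℝ := ε / (2 * (∑ y ∈ P, |c y| + 1)) with hηdef
  have hη : 0 < η := by positivity
  obtain ⟨hθ, hhθ⟩ := exists_network_sum_bump hη P hP c
  refine ⟨mθ, hθ, hmθ, ?_, fun hconc hmono b => ?_, fun S => ?_⟩
  · rw [hhθ]
    exact (integrable_finsetSum P fun y _ => (integrable_bump hη y).const_mul (c y)).integrableOn
  · rw [hhθ]
    refine Finset.sum_nonneg fun y hy => mul_nonneg (hcnn hconc ?_ y hy) (bump_nonneg hη y b)
    intro M hM hmax x hx
    obtain ⟨S, rfl⟩ := hsum' x hx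
    -- Since `m ≥ 0`, the largest attained sum is that of all of `V`, where a monotone `F` is
    -- maximal.
    have hMtop : M = ∑ s, m (z s) := by
      obtain ⟨T, rfl⟩ := hsum' M hM
      refine le_antisymm (Finset.sum_le_sum_of_subset_of_nonneg (Finset.subset_univ T)
        fun s _ _ => hm _) ?_
      rcases Finset.mem_insert.1 (hsum Finset.univ) with h | h
      · rw [h]; exact Finset.sum_nonneg fun s _ => hm _
      · exact hmax _ h
    rw [hMtop, ← hF, ← hF]
    exact hmono (Finset.subset_univ S)
  · simp only [hmeq]
    rw [hF, hhθ, ← hc _ (hsum S)]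
    refine (abs_doubleIntegral_sum_bump_sub_le hη P hP c _).trans ?_
    rw [hηdef]
    calc (∑ y ∈ P, |c y|) * (2 * (ε / (2 * (∑ y ∈ P, |c y| + 1))))
        = (∑ y ∈ P, |c y|) / (∑ y ∈ P, |c y| + 1) * ε := by field_simp
      _ ≤ 1 * ε := by
          gcongr
          exact (div_le_one (by linarith)).2 (by linarith)
      _ = ε := one_mul ε
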